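/- Let $\phi$ be a flow on a locally compact Hausdorff space $M$, written $x\cdot t$. For $X\subset M$ put $A^+(X)=\{x\in X : x\cdot[0,\infty)\subset X\}$ and $\operatorname{Inv}X=\{x\in X : x\cdot\mathbb R\subset X\}$. A compact set $X$ is an isolating neighborhood if $\operatorname{Inv}X\subset\operatorname{int}X$. An index pair for $S$ is a pair of compact sets $L\subset N$ such that (i) $S\subset\operatorname{int}(N\setminus L)$ and $S=\operatorname{Inv}(\operatorname{cl}(N\setminus L))$; (ii) if $x\in L$, $t\ge 0$ and $x\cdot[0,t]\subset N$, then $x\cdot[0,t]\subset L$; (iii) if $x\in N$ and $x\cdot[0,\infty)\not\subset N$, then there is $t\ge 0$ with $x\cdot[0,t]\subset N$ and $x\cdot t\in L$. An index pair for $X$ is an index pair for $\operatorname{Inv}X$. The quotient $N/L$ is pointed by $[L]$, where $N/\emptyset=N\sqcup\{*\}$; maps between such quotients and homotopies are based. A flow map $N_1/L_1\to N_2/L_2$ between index pairs for $S$ is a map of the form $$[x]\mapsto [x\cdot 3t]\ \text{ if } x\cdot[0,2t]\subset N_1\setminus L_1 \text{ and } x\cdot[t,3t]\subset N_2\setminus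 L_2,\qquad [x]\mapsto [L_2]\ \text{ otherwise},$$ where $t\ge0$ is so large that $x\cdot[-t,t]\subset\operatorname{cl}(N_i\setminus L_i)$ implies $x\in N_j\setminus L_j$ for $\{i,j\}=\{1,2\}$. The Conley index $I(X)$ is the system of all pointed spaces $N/L$, for $(N,L)$ an index pair for $X$, together with the flow maps between them; a map from a pointed space $Z$ to $I(X)$ is a family of based homotopy classes of maps $Z\to N/L$, one for each index pair for $X$, which is compatible (up to homotopy) with all flow maps. **Proposition.** Let $X$ be an isolating neighborhood, let $A$ be a compact space, $B\subset A$ compact, and let $f:A\to X$ be continuous such that 1. if $x\in A^+(X)\cap f(A)$, then $x\cdot[0,\infty)\cap\partial X=\emptyset$; 2. $f(B)\cap A^+(X)=\emptyset$. Say that an index pair $(N,L)$ for $X$ surrounds $f$ if $f(A)\subset N\subset X$, $f(B)\subset L$, and $x\cdot[0,\infty)\cap L=\emptyset$ for every $x\in A^+(X)\cap f(A)$ (the last condition holds automatically if $L\cap A^+(X)=\emptyset$, in particular if $L$ is positively invariant relative to $X$). Then: * There is an index pair for $X$ that surrounds $f$, and every such pair $(N,L)$ gives a continuous based map $f_{(N,L)}:A/B\to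 N/L$, $[a]\mapsto[f(a)]$. * If $(N_1,L_1)$ and $(N_2,L_2)$ surround $f$, then there is a flow map $N_1/L_1\to N_2/L_2$, and for every such flow map $F$ the maps $F\circ f_{(N_1,L_1)}$ and $f_{(N_2,L_2)}$ are homotopic relative to the base point. * Consequently $f$ gives a well-defined map $A/B\to I(X)$: there is exactly one map $A/B\to I(X)$ whose component at $(N,L)$ is the class of $f_{(N,L)}$ for every index pair $(N,L)$ that surrounds $f$. -/

import Mathlib

open Set

namespace ConleyMap

section Collapse

variable {Y Z W : Type*}

/-- The subset `B ∪ {*}` of `Y ⊔ {*}`. -/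
def withPoint (B : Set Y) : Set (Y ⊕ Unit) := {a | ∀ y, a = Sum.inl y → y ∈ B}

/-- The equivalence relation on `Y ⊔ {*}` that collapses `B ∪ {*}` to one point. -/
def collapseSetoid (B : Set Y) : Setoid (Y ⊕ Unit) where
  r a b := a = b ∨ (a ∈ withPoint B ∧ b ∈ withPoint B)
  iseqv :=
    { refl := fun _ => Or.inl rfl
      symm := by
        rintro a b (h | h)
        · exact Or.inl h.symm
        · exact Or.inr ⟨h.2, h.1⟩
      trans := by
        rintro a b c (rfl | h) (rfl | h')
        · exact Or.inl rfl
        · exact Or.inr h'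
        · exact Or.inr h
        · exact Or.inr ⟨h.1, h'.2⟩ }

/-- The pointed space `Y / B`. A disjoint point is added before `B` is collapsed, so that
`Y / ∅` is `Y` with a disjoint base point; for nonempty `B` this is the usual quotient. -/
def Collapse (B : Set Y) : Type _ := Quotient (collapseSetoid B)

instance [TopologicalSpace Y] (B : Set Y) : TopologicalSpace (Collapse B) :=
  inferInstanceAs (TopologicalSpace (Quotient (collapseSetoid B)))

/-- The class `[y]` in `Y / B`. -/
def Collapse.mk (B : Set Y) (y : Y) : Collapse B := Quotient.mk (collapseSetoid B) (Sum.inl y)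

/-- The base point `[B]` of `Y / B`. -/
def Collapse.pt (B : Set Y) : Collapse B := Quotient.mk (collapseSetoid B) (Sum.inr ())

theorem Collapse.mk_eq_pt {B : Set Y} {y : Y} (h : y ∈ B) : Collapse.mk B y = Collapse.pt B :=
  Quotient.sound (Or.inr ⟨fun _ e => Sum.inl.inj e ▸ h, fun _ e => by cases e⟩)

theorem Collapse.mk_eq_pt_iff {B : Set Y} {y : Y} :
    Collapse.mk B y = Collapse.pt B ↔ y ∈ B := by
  refine ⟨fun h => ?_, Collapse.mk_eq_pt⟩
  rcases Quotient.exact h with h | h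
  · cases h
  · exact h.1 y rfl

theorem Collapse.continuous_mk [TopologicalSpace Y] (B : Set Y) :
    Continuous (Collapse.mk B) :=
  continuous_quotient_mk'.comp continuous_inl

variable [TopologicalSpace Y] [TopologicalSpace Z] [TopologicalSpace W]

/-- Continuous base-point-preserving maps `Y / B → Z / C`. -/
def BasedMap (B : Set Y) (C : Set Z) : Type _ :=
  {g : C(Collapse B, Collapse C) // g (Collapse.pt B) = Collapse.pt C}

/-- Composition of based maps. -/
def BasedMap.comp {B : Set Y} {C : Set Z} {D : Set W} (F : BasedMap C D) (g : BasedMap B C) :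
    BasedMap B D :=
  ⟨F.1.comp g.1, by rw [ContinuousMap.comp_apply, g.2, F.2]⟩

/-- Homotopy of based maps through based maps. -/
def BasedMap.Homotopic {B : Set Y} {C : Set Z} (g h : BasedMap B C) : Prop :=
  ContinuousMap.HomotopicRel g.1 h.1 {Collapse.pt B}

theorem BasedMap.Homotopic.postcomp {B : Set Y} {C : Set Z} {D : Set W} (F : BasedMap C D)
    {g h : BasedMap B C} (H : g.Homotopic h) : (F.comp g).Homotopic (F.comp h) :=
  ContinuousMap.HomotopicRel.comp_continuousMap H F.1

instance basedSetoid (B : Set Y) (C : Set Z) : Setoid (BasedMap B C) where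
  r := BasedMap.Homotopic
  iseqv :=
    { refl := fun g => ContinuousMap.HomotopicRel.refl g.1
      symm := fun h => ContinuousMap.HomotopicRel.symm h
      trans := fun h h' => ContinuousMap.HomotopicRel.trans h h' }

/-- Based homotopy classes of maps `Y / B → Z / C`. -/
def BasedClass (B : Set Y) (C : Set Z) : Type _ := Quotient (basedSetoid B C)

/-- The based homotopy class of a based map. -/
def BasedMap.toClass {B : Set Y} {C : Set Z} (g : BasedMap B C) : BasedClass B C :=
  Quotient.mk (basedSetoid B C) g

/-- Composition of a homotopy class with a based map. -/
def BasedClass.postcomp {B : Set Y} {C : Set Z} {D : Set W} (F : BasedMap C D) :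
    BasedClass B C → BasedClass B D :=
  Quotient.map (fun g => F.comp g) (fun _ _ H => BasedMap.Homotopic.postcomp F H)

/-- The map `Y / B → Z / C` induced by a continuous map of pairs `(Y, B) → (Z, C)`. -/
def BasedMap.ofPair (B : Set Y) (C : Set Z) (f : C(Y, Z)) (hf : MapsTo f B C) :
    BasedMap B C :=
  ⟨{ toFun := Quotient.lift
        (Sum.elim (fun y => Collapse.mk C (f y)) (fun _ => Collapse.pt C)) (by
          have key : ∀ a : Y ⊕ Unit, a ∈ withPoint B →
              Sum.elim (fun y => Collapse.mk C (f y)) (fun _ => Collapse.pt C) a =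
                Collapse.pt C := by
            rintro (y | _) h
            · exact Collapse.mk_eq_pt (hf (h y rfl))
            · rfl
          rintro a b (rfl | ⟨ha, hb⟩)
          · rfl
          · rw [key a ha, key b hb])
     continuous_toFun := by
        refine Continuous.quotient_lift ?_ _
        exact ((Collapse.continuous_mk C).comp f.continuous).sumElim continuous_const }, rfl⟩

theorem BasedMap.ofPair_mk (B : Set Y) (C : Set Z) (f : C(Y, Z)) (hf : MapsTo f B C) (y : Y) :
    (BasedMap.ofPair B C f hf).1 (Collapse.mk B y) = Collapse.mk C (f y) := rfl

end Collapse

section Conley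

variable {M : Type*} [TopologicalSpace M]

/-- `A⁺(X)`: the points of `X` whose forward orbit stays in `X`. -/
def posInv (φ : Flow ℝ M) (X : Set M) : Set M := {x ∈ X | ∀ t : ℝ, 0 ≤ t → φ t x ∈ X}

/-- `Inv X`: the maximal invariant subset of `X`. -/
def maxInv (φ : Flow ℝ M) (X : Set M) : Set M := {x ∈ X | ∀ t : ℝ, φ t x ∈ X}

/-- `X` is an isolating neighborhood. -/
def IsIsolatingNhd (φ : Flow ℝ M) (X : Set M) : Prop :=
  IsCompact X ∧ maxInv φ X ⊆ interior X

/-- An index pair `(N, L)` for the set `S`. -/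
structure IndexPair (φ : Flow ℝ M) (S : Set M) where
  /-- The total set. -/
  N : Set M
  /-- The exit set. -/
  L : Set M
  compact_N : IsCompact N
  compact_L : IsCompact L
  subset : L ⊆ N
  nhd : S ⊆ interior (N \ L)
  maxInv_eq : maxInv φ (closure (N \ L)) = S
  posInvariant : ∀ x ∈ L, ∀ t : ℝ, 0 ≤ t → (∀ s ∈ Icc 0 t, φ s x ∈ N) → ∀ s ∈ Icc 0 t, φ s x ∈ L
  exit : ∀ x ∈ N, (¬ ∀ t : ℝ, 0 ≤ t → φ t x ∈ N) →
    ∃ t : ℝ, 0 ≤ t ∧ (∀ s ∈ Icc 0 t, φ s x ∈ N) ∧ φ t x ∈ L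

variable {φ : Flow ℝ M} {S : Set M}

/-- The subset of the space `N` that is collapsed to form `N / L`. -/
def IndexPair.sub (P : IndexPair φ S) : Set P.N := {x | (x : M) ∈ P.L}

/-- `x·[0,2t] ⊆ N₁ \ L₁` and `x·[t,3t] ⊆ N₂ \ L₂`. -/
def FlowCond (P Q : IndexPair φ S) (t : ℝ) (x : M) : Prop :=
  (∀ s ∈ Icc 0 (2 * t), φ s x ∈ P.N \ P.L) ∧ ∀ s ∈ Icc t (3 * t), φ s x ∈ Q.N \ Q.L

open Classical in
/-- `x ↦ [x·3t]` if `x·[0,2t] ⊆ N₁ \ L₁` and `x·[t,3t] ⊆ N₂ \ L₂`, and `x ↦ [L₂]` otherwise. -/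
noncomputable def flowFun (P Q : IndexPair φ S) (t : ℝ) (ht : 0 ≤ t) (x : P.N) :
    Collapse Q.sub :=
  if h : FlowCond P Q t x then
    Collapse.mk Q.sub ⟨φ (3 * t) x, (h.2 (3 * t) ⟨by linarith, le_rfl⟩).1⟩
  else Collapse.pt Q.sub

/-- `t` is so large that an orbit segment of length `2t` that lies in the closure of `N₁ \ L₁`
has its midpoint in `N₂ \ L₂`. -/
def LargeTime (P Q : IndexPair φ S) (t : ℝ) : Prop :=
  ∀ x : M, (∀ s ∈ Icc (-t) t, φ s x ∈ closure (P.N \ P.L)) → x ∈ Q.N \ Q.L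

/-- `F : N₁ / L₁ → N₂ / L₂` is one of the flow maps, i.e. the map
`[x] ↦ [x·3t]` if `x·[0,2t] ⊆ N₁ \ L₁` and `x·[t,3t] ⊆ N₂ \ L₂`, and `[x] ↦ [L₂]` otherwise,
for some time `t` that is large for the two pairs. -/
def IsFlowMap (P Q : IndexPair φ S) (F : BasedMap P.sub Q.sub) : Prop :=
  ∃ (t : ℝ) (ht : 0 ≤ t), LargeTime P Q t ∧ LargeTime Q P t ∧
    ∀ x : P.N, F.1 (Collapse.mk P.sub x) = flowFun P Q t ht x

/-- A map, up to homotopy, from the pointed space `A / B` to the Conley index of `S`, the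
connected simple system made of the pointed spaces `N / L` for all index pairs of `S` and the
flow maps between them: a based homotopy class of maps `A / B → N / L` for every index pair,
compatible with all flow maps. -/
@[ext]
structure MapToConleyIndex {A : Type*} [TopologicalSpace A] (B : Set A) (φ : Flow ℝ M)
    (S : Set M) where
  /-- The component at an index pair. -/
  app : ∀ P : IndexPair φ S, BasedClass B P.sub
  naturality : ∀ (P Q : IndexPair φ S) (F : BasedMap P.sub Q.sub), IsFlowMap P Q F →
    (app P).postcomp F = app Q

/-- The hypothesis on a pair `(K, K')` of subsets of `X` under which an index pair around it
is found: forward orbits that start in `K` and stay in `X` do not meet the frontier of `X`, and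
no forward orbit that starts in `K'` stays in `X`. -/
structure Admissible (φ : Flow ℝ M) (X K K' : Set M) : Prop where
  compact_fst : IsCompact K
  compact_snd : IsCompact K'
  subset_fst : K ⊆ X
  subset_snd : K' ⊆ X
  avoids_frontier : ∀ x ∈ posInv φ X ∩ K, ∀ t : ℝ, 0 ≤ t → φ t x ∉ frontier X
  disjoint_posInv : K' ∩ posInv φ X = ∅

/-- `(N, L)` is an index pair inside `X` around `(f(A), f(B))`: `f(A) ⊆ N ⊆ X`, `f(B) ⊆ L`, and
a forward orbit that starts in `f(A)` and stays in `X` never meets the exit set `L`. -/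
structure Surrounds {A : Type*} [TopologicalSpace A] {X : Set M} (P : IndexPair φ (maxInv φ X))
    (f : C(A, M)) (B : Set A) : Prop where
  N_subset : P.N ⊆ X
  mapsTo_N : ∀ a, f a ∈ P.N
  mapsTo_L : ∀ b ∈ B, f b ∈ P.L
  avoids_L : ∀ x ∈ posInv φ X ∩ range f, ∀ t : ℝ, 0 ≤ t → φ t x ∉ P.L

/-- The map `A / B → N / L`, `[a] ↦ [f(a)]`. -/
def inducedMap {A : Type*} [TopologicalSpace A] {X : Set M} {P : IndexPair φ (maxInv φ X)}
    {f : C(A, M)} {B : Set A} (h : Surrounds P f B) : BasedMap B P.sub :=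
  BasedMap.ofPair B P.sub ⟨fun a => ⟨f a, h.mapsTo_N a⟩, f.continuous.subtype_mk _⟩ h.mapsTo_L

end Conley

end ConleyMap

/-! Existence. Let `W` be a compact neighborhood of Inv X, inside X, such that forward orbits from
`W` that stay in X stay in its interior. Take `N` to be the points with backward orbit in X,
together with everything reached inside X from `W ∪ f(A)`; take `L` to be everything reached inside
X from `(N ∩ ∂X) ∪ f(B)`. The hypotheses on f say exactly that this starting set of `L` misses
A⁺(X). Hence its points leave X within a bounded time, which makes `L` compact, and `L` misses A⁺(X)
too (`Admissible.exists_indexPair`).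

Compatibility. For large `t`, points `f(a)` satisfy the condition defining the flow map exactly when
their orbit stays in `N₂ \ L₂` over `[0, 3t]` (`exists_time_flowCond_iff`). So the flow map after
`f` only pushes `f` forward inside `N₂ / L₂`, and shrinking the time to 0 is a homotopy back to `f`
(`inducedMap_homotopic_of_forward`).

The map to the index. Flow maps between two given pairs are all homotopic and compose to flow maps
up to homotopy (`IsFlowMap.comp_homotopic`), so a map to the index amounts to one component; any
surrounding pair supplies it. -/

namespace ConleyMap

/-! ### Based maps and homotopies on collapsed spaces -/

section CollapseMaps

variable {Y Z W : Type*}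

theorem Collapse.ind {B : Set Y} {p : Collapse B → Prop} (hmk : ∀ y, p (Collapse.mk B y))
    (hpt : p (Collapse.pt B)) (q : Collapse B) : p q := by
  induction q using Quotient.ind with
  | _ a =>
    rcases a with y | _
    · exact hmk y
    · exact hpt

variable [TopologicalSpace Y] [TopologicalSpace Z] [TopologicalSpace W]

/-- The continuous map out of `Y / B` induced by a continuous map that is constant on `B`. -/
def Collapse.lift (B : Set Y) (u : C(Y, Z)) (z : Z) (hu : ∀ b ∈ B, u b = z) :
    C(Collapse B, Z) where
  toFun := Quotient.lift (Sum.elim u fun _ => z) (by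
    have key : ∀ a : Y ⊕ Unit, a ∈ withPoint B → Sum.elim u (fun _ => z) a = z := by
      rintro (y | _) h
      · exact hu y (h y rfl)
      · rfl
    rintro a b (rfl | ⟨ha, hb⟩)
    · rfl
    · rw [key a ha, key b hb])
  continuous_toFun := Continuous.quotient_lift (u.continuous.sumElim continuous_const) _

theorem BasedMap.ext {B : Set Y} {C : Set Z} {g h : BasedMap B C}
    (H : ∀ y, g.1 (Collapse.mk B y) = h.1 (Collapse.mk B y)) : g = h :=
  Subtype.ext (ContinuousMap.ext (Collapse.ind H (g.2.trans h.2.symm)))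

/-- Currying turns the family into a map from `Y` to a path space, which descends to `Y / B`. This
avoids asking whether the product of a quotient map with the unit interval is a quotient map. -/
theorem BasedMap.homotopic_of_family {B : Set Y} {C : Set Z} {g h : BasedMap B C}
    (H : C(Y × unitInterval, Collapse C)) (hB : ∀ b ∈ B, ∀ s, H (b, s) = Collapse.pt C)
    (h0 : ∀ y, H (y, 0) = g.1 (Collapse.mk B y)) (h1 : ∀ y, H (y, 1) = h.1 (Collapse.mk B y)) :
    g.Homotopic h := by
  let K : C(Collapse B, C(unitInterval, Collapse C)) :=
    Collapse.lift B H.curry (ContinuousMap.const _ (Collapse.pt C))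
      fun b hb => ContinuousMap.ext fun s => hB b hb s
  have hK : ∀ s, K (Collapse.pt B) s = Collapse.pt C := fun s => rfl
  refine ⟨⟨⟨⟨fun p => K p.2 p.1, ?_⟩, ?_, ?_⟩, ?_⟩⟩
  · exact (ContinuousMap.continuous_uncurry_of_continuous K).comp continuous_swap
  · exact Collapse.ind h0 ((hK 0).trans g.2.symm)
  · exact Collapse.ind h1 ((hK 1).trans h.2.symm)
  · rintro s x rfl
    exact (hK s).trans g.2.symm

theorem BasedMap.Homotopic.precomp {B : Set Y} {C : Set Z} {D : Set W} {F G : BasedMap C D}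
    (H : F.Homotopic G) (g : BasedMap B C) : (F.comp g).Homotopic (G.comp g) := by
  obtain ⟨K⟩ := H
  refine ⟨⟨⟨⟨fun p => K (p.1, g.1 p.2), ?_⟩, ?_, ?_⟩, ?_⟩⟩
  · exact K.continuous.comp (continuous_fst.prodMk (g.1.continuous.comp continuous_snd))
  · exact fun x => K.apply_zero _
  · exact fun x => K.apply_one _
  · rintro s x rfl
    exact K.eq_fst s g.2

theorem BasedMap.Homotopic.symm {B : Set Y} {C : Set Z} {F G : BasedMap B C}
    (h : F.Homotopic G) : G.Homotopic F :=
  ContinuousMap.HomotopicRel.symm h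

theorem BasedMap.Homotopic.trans {B : Set Y} {C : Set Z} {F G H : BasedMap B C}
    (h : F.Homotopic G) (h' : G.Homotopic H) : F.Homotopic H :=
  ContinuousMap.HomotopicRel.trans h h'

end CollapseMaps

/-! ### Orbit segments and compactness in time -/

section FlowSegments

variable {M Y : Type*} [TopologicalSpace M] [TopologicalSpace Y] (φ : Flow ℝ M)

/-- Rescaling to a fixed compact interval lets the tube lemma handle segments whose endpoints vary.
-/
theorem forall_mem_Icc_iff_forall_unit {a b : ℝ} (hab : a ≤ b) {p : ℝ → Prop} :
    (∀ s ∈ Icc a b, p s) ↔ ∀ r ∈ Icc (0 : ℝ) 1, p (a + r * (b - a)) := by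
  refine ⟨fun h r hr => h _ ⟨?_, ?_⟩, fun h s hs => ?_⟩
  · nlinarith [hr.1, hr.2]
  · nlinarith [hr.1, hr.2]
  · rcases hab.eq_or_lt with rfl | hlt
    · obtain rfl : s = a := le_antisymm hs.2 hs.1
      simpa using h 0 ⟨le_rfl, zero_le_one⟩
    · have hpos : 0 < b - a := sub_pos.2 hlt
      have := h ((s - a) / (b - a)) ⟨div_nonneg (by linarith [hs.1]) hpos.le,
        (div_le_one hpos).2 (by linarith [hs.2])⟩
      rwa [div_mul_cancel₀ _ hpos.ne', add_sub_cancel] at this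

variable {g : Y → M} {a b : Y → ℝ}

theorem isOpen_setOf_segment_subset (hg : Continuous g) (ha : Continuous a) (hb : Continuous b)
    (hab : ∀ y, a y ≤ b y) {O : Set M} (hO : IsOpen O) :
    IsOpen {y | ∀ s ∈ Icc (a y) (b y), φ s (g y) ∈ O} := by
  simp_rw [forall_mem_Icc_iff_forall_unit (hab _)]
  rw [isOpen_iff_mem_nhds]
  intro y hy
  refine isCompact_Icc.eventually_forall_of_forall_eventually fun r hr => ?_
  have hc : Continuous fun p : Y × ℝ => φ (a p.1 + p.2 * (b p.1 - a p.1)) (g p.1) :=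
    φ.continuous (by fun_prop) (by fun_prop)
  exact (hO.preimage hc).mem_nhds (hy r hr)

theorem isClosed_setOf_segment_subset (hg : Continuous g) (ha : Continuous a) (hb : Continuous b)
    (hab : ∀ y, a y ≤ b y) {C : Set M} (hC : IsClosed C) :
    IsClosed {y | ∀ s ∈ Icc (a y) (b y), φ s (g y) ∈ C} := by
  simp_rw [forall_mem_Icc_iff_forall_unit (hab _), ofPred_forall]
  refine isClosed_biInter fun r _ => ?_
  exact hC.preimage (φ.continuous (by fun_prop) hg)

/-- If the points of `K` whose orbit segments over all times `J T` stay in `C` lie in the open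
set `U`, then a single time `T` suffices. -/
theorem exists_time_of_forall_time [T2Space M] {K C U : Set M} (hK : IsCompact K)
    (hC : IsClosed C) (hU : IsOpen U) {J : ℝ → Set ℝ} (hJ : Monotone J)
    (h : ∀ x ∈ K, (∀ T, ∀ s ∈ J T, φ s x ∈ C) → x ∈ U) :
    ∃ T, 0 ≤ T ∧ ∀ x ∈ K, (∀ s ∈ J T, φ s x ∈ C) → x ∈ U := by
  let V : ℝ → Set M := fun T => K ∩ {x | ∀ s ∈ J T, φ s x ∈ C}
  have hVanti : Antitone V := fun T T' hT x hx => ⟨hx.1, fun s hs => hx.2 s (hJ hT hs)⟩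
  have hVc : ∀ T, IsCompact (V T) := fun T => by
    refine hK.inter_right ?_
    simp_rw [ofPred_forall]
    exact isClosed_biInter fun s _ => hC.preimage (φ.continuous continuous_const continuous_id)
  -- The sets `V T` are compact and decrease to a subset of `U`, so one of them already lies in `U`.
  obtain ⟨T, hT⟩ := exists_subset_nhds_of_isCompact hVanti.directed_ge hVc (U := U) fun x hx =>
    hU.mem_nhds (h x (mem_iInter.1 hx 0).1 fun T => (mem_iInter.1 hx T).2)
  exact ⟨max T 0, le_max_right _ _, fun x hx hs =>
    hT (hVanti (le_max_left T 0) ⟨hx, hs⟩)⟩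

end FlowSegments

/-! ### Existence of a surrounding index pair -/

section Existence

variable {M : Type*} [TopologicalSpace M] {φ : Flow ℝ M} {X Z : Set M}

theorem maxInv_mono {X Y : Set M} (h : X ⊆ Y) : maxInv φ X ⊆ maxInv φ Y :=
  fun _ hx => ⟨h hx.1, fun t => h (hx.2 t)⟩

theorem flow_mem_maxInv {x : M} (hx : x ∈ maxInv φ X) (t : ℝ) : φ t x ∈ maxInv φ X :=
  ⟨hx.2 t, fun s => by rw [← φ.map_add]; exact hx.2 _⟩

theorem mem_of_forall_segment {x : M} {t : ℝ} (ht : 0 ≤ t) (h : ∀ s ∈ Icc 0 t, φ s x ∈ X) :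
    x ∈ X := by
  simpa using h 0 ⟨le_rfl, ht⟩

theorem mem_posInv_iff {x : M} : x ∈ posInv φ X ↔ ∀ t : ℝ, 0 ≤ t → φ t x ∈ X :=
  ⟨fun h => h.2, fun h => ⟨by simpa using h 0 le_rfl, h⟩⟩

theorem flow_mem_posInv {x : M} (hx : x ∈ posInv φ X) {t : ℝ} (ht : 0 ≤ t) :
    φ t x ∈ posInv φ X :=
  mem_posInv_iff.2 fun s hs => by rw [← φ.map_add]; exact hx.2 _ (add_nonneg hs ht)

theorem mem_posInv_of_flow_mem {x : M} {t : ℝ} (h : ∀ s ∈ Icc 0 t, φ s x ∈ X)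
    (hx : φ t x ∈ posInv φ X) : x ∈ posInv φ X := by
  refine mem_posInv_iff.2 fun s hs => ?_
  rcases le_total s t with hst | hst
  · exact h s ⟨hs, hst⟩
  · have := hx.2 (s - t) (sub_nonneg.2 hst)
    rwa [← φ.map_add, sub_add_cancel] at this

theorem isCompact_maxInv [T2Space M] (hX : IsCompact X) : IsCompact (maxInv φ X) := by
  have : maxInv φ X = X ∩ ⋂ t : ℝ, {x | φ t x ∈ X} := by ext; simp [maxInv]
  rw [this]
  exact hX.inter_right (isClosed_iInter fun t =>
    hX.isClosed.preimage (φ.continuous continuous_const continuous_id))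

/-- The points of `X` whose backward orbit stays in `X`. -/
def negInv (φ : Flow ℝ M) (X : Set M) : Set M := {x ∈ X | ∀ t : ℝ, t ≤ 0 → φ t x ∈ X}

theorem isClosed_negInv (hX : IsClosed X) : IsClosed (negInv φ X) := by
  have : negInv φ X = X ∩ ⋂ (t : ℝ) (_ : t ≤ 0), {x | φ t x ∈ X} := by ext; simp [negInv]
  rw [this]
  exact hX.inter (isClosed_biInter fun t _ =>
    hX.preimage (φ.continuous continuous_const continuous_id))

theorem flow_mem_negInv {x : M} (hx : x ∈ negInv φ X) {t : ℝ} (ht : 0 ≤ t)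
    (h : ∀ s ∈ Icc 0 t, φ s x ∈ X) : φ t x ∈ negInv φ X := by
  refine ⟨h t ⟨ht, le_rfl⟩, fun s hs => ?_⟩
  rw [← φ.map_add]
  rcases le_total 0 (s + t) with h0 | h0
  · exact h _ ⟨h0, by linarith⟩
  · exact hx.2 _ h0

theorem mem_maxInv_of_mem_negInv_of_mem_posInv {x : M} (hn : x ∈ negInv φ X)
    (hp : x ∈ posInv φ X) : x ∈ maxInv φ X :=
  ⟨hn.1, fun t => (le_total 0 t).elim (hp.2 t) (hn.2 t)⟩

/-- The union of the forward orbit segments in `X` that start in `Z`. -/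
def forwardSat (φ : Flow ℝ M) (X Z : Set M) : Set M :=
  {y | ∃ x ∈ Z, ∃ t : ℝ, 0 ≤ t ∧ (∀ s ∈ Icc 0 t, φ s x ∈ X) ∧ φ t x = y}

/-- The union of the forward orbit segments in `X` of length at most `T` that start in `Z`. -/
def forwardSatUpTo (φ : Flow ℝ M) (X Z : Set M) (T : ℝ) : Set M :=
  {y | ∃ x ∈ Z, ∃ t ∈ Icc 0 T, (∀ s ∈ Icc 0 t, φ s x ∈ X) ∧ φ t x = y}

theorem forwardSat_subset : forwardSat φ X Z ⊆ X := by
  rintro _ ⟨x, _, t, ht, h, rfl⟩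
  exact h t ⟨ht, le_rfl⟩

theorem subset_forwardSat (hZ : Z ⊆ X) : Z ⊆ forwardSat φ X Z := fun x hx =>
  ⟨x, hx, 0, le_rfl, fun s hs => by
    obtain rfl : s = 0 := le_antisymm hs.2 hs.1
    simpa using hZ hx, by simp⟩

theorem flow_mem_forwardSat {x : M} (hx : x ∈ forwardSat φ X Z) {t : ℝ} (ht : 0 ≤ t)
    (h : ∀ s ∈ Icc 0 t, φ s x ∈ X) : φ t x ∈ forwardSat φ X Z := by
  obtain ⟨z, hz, r, hr, hzr, rfl⟩ := hx
  refine ⟨z, hz, t + r, add_nonneg ht hr, fun s hs => ?_, φ.map_add _ _ _⟩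
  rcases le_total s r with hsr | hsr
  · exact hzr s ⟨hs.1, hsr⟩
  · have := h (s - r) ⟨sub_nonneg.2 hsr, by linarith [hs.2]⟩
    rwa [← φ.map_add, sub_add_cancel] at this

theorem disjoint_forwardSat_posInv (hZ : Disjoint Z (posInv φ X)) :
    Disjoint (forwardSat φ X Z) (posInv φ X) := by
  rw [disjoint_left] at hZ ⊢
  rintro _ ⟨x, hx, t, _, h, rfl⟩ hp
  exact hZ hx (mem_posInv_of_flow_mem h hp)

theorem isCompact_forwardSatUpTo (hX : IsClosed X) (hZ : IsCompact Z) (T : ℝ) :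
    IsCompact (forwardSatUpTo φ X Z T) := by
  -- The absolute value keeps the endpoints ordered for every real parameter; it is invisible on
  -- `Icc 0 T`.
  have hc : IsClosed {p : M × ℝ | ∀ s ∈ Icc 0 |p.2|, φ s p.1 ∈ X} :=
    isClosed_setOf_segment_subset φ continuous_fst continuous_const
      (continuous_abs.comp continuous_snd) (fun p => abs_nonneg p.2) hX
  have : forwardSatUpTo φ X Z T = (fun p : M × ℝ => φ p.2 p.1) ''
      ((Z ×ˢ Icc 0 T) ∩ {p : M × ℝ | ∀ s ∈ Icc 0 |p.2|, φ s p.1 ∈ X}) := by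
    ext y
    constructor
    · rintro ⟨x, hx, t, ht, h, rfl⟩
      exact ⟨(x, t), ⟨⟨hx, ht⟩, by simpa [abs_of_nonneg ht.1] using h⟩, rfl⟩
    · rintro ⟨⟨x, t⟩, ⟨⟨hx, ht⟩, h⟩, rfl⟩
      exact ⟨x, hx, t, ht, by simpa [abs_of_nonneg ht.1] using h, rfl⟩
  rw [this]
  exact ((hZ.prod isCompact_Icc).inter_right hc).image (φ.continuous continuous_snd continuous_fst)

/-- Every point of `Z` leaves X, so by compactness (the case `U = ∅`) there is a uniform bound on
the length of the segments. -/
theorem isCompact_forwardSat_of_disjoint [T2Space M] (hX : IsClosed X) (hZ : IsCompact Z)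
    (hd : Disjoint Z (posInv φ X)) : IsCompact (forwardSat φ X Z) := by
  obtain ⟨T, hT0, hT⟩ := exists_time_of_forall_time φ (U := ∅) hZ hX isOpen_empty
    (J := fun T => Icc 0 T) (fun T T' h => Icc_subset_Icc_right h) fun x hx h =>
      (disjoint_left.1 hd hx (mem_posInv_iff.2 fun t ht => h t t ⟨ht, le_rfl⟩)).elim
  have : forwardSat φ X Z = forwardSatUpTo φ X Z T := by
    ext y
    constructor
    · rintro ⟨x, hx, t, ht, h, rfl⟩
      refine ⟨x, hx, t, ⟨ht, ?_⟩, h, rfl⟩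
      by_contra! hlt
      exact hT x hx fun s hs => h s ⟨hs.1, hs.2.trans hlt.le⟩
    · rintro ⟨x, hx, t, ht, h, rfl⟩
      exact ⟨x, hx, t, ht.1, h, rfl⟩
  rw [this]
  exact isCompact_forwardSatUpTo hX hZ T

/-- If a limit point leaves X at a backward time `s`, so do nearby points. Segments from `Z` ending
at them are then no longer than `-s`, and the sets of bounded length are compact. -/
theorem isClosed_negInv_union_forwardSat [T2Space M] (hX : IsCompact X) (hZ : IsCompact Z) :
    IsClosed (negInv φ X ∪ forwardSat φ X Z) := by
  refine isClosed_of_closure_subset fun y hy => ?_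
  rw [closure_union, (isClosed_negInv hX.isClosed).closure_eq] at hy
  by_cases hyn : y ∈ negInv φ X
  · exact Or.inl hyn
  replace hy := hy.resolve_left hyn
  have hyX : y ∈ X := closure_minimal forwardSat_subset hX.isClosed hy
  obtain ⟨s, hs, hsX⟩ : ∃ s ≤ 0, φ s y ∉ X := by
    by_contra! h
    exact hyn ⟨hyX, h⟩
  have hU : IsOpen {z | φ s z ∈ Xᶜ} :=
    hX.isClosed.isOpen_compl.preimage (φ.continuous continuous_const continuous_id)
  have hsub : {z | φ s z ∈ Xᶜ} ∩ forwardSat φ X Z ⊆ forwardSatUpTo φ X Z (-s) := by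
    rintro _ ⟨hz, x, hx, t, ht, h, rfl⟩
    refine ⟨x, hx, t, ⟨ht, ?_⟩, h, rfl⟩
    by_contra! hlt
    refine hz ?_
    rw [← φ.map_add]
    exact h _ ⟨by linarith, by linarith⟩
  have hmem := closure_mono hsub (hU.inter_closure ⟨hsX, hy⟩)
  rw [(isCompact_forwardSatUpTo hX.isClosed hZ _).isClosed.closure_eq] at hmem
  obtain ⟨x, hx, t, ht, h⟩ := hmem
  exact Or.inr ⟨x, hx, t, ht.1, h⟩

/-- A forward orbit that leaves the closed set `X` reaches the frontier of `X` while it is still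
in `X`. -/
theorem exists_flow_mem_frontier (hX : IsClosed X) {x : M} (hx : x ∈ X)
    (h : x ∉ posInv φ X) : ∃ t : ℝ, 0 ≤ t ∧ (∀ s ∈ Icc 0 t, φ s x ∈ X) ∧ φ t x ∈ frontier X := by
  obtain ⟨r, hr0, hr⟩ : ∃ r : ℝ, 0 ≤ r ∧ φ r x ∉ X := by
    by_contra! hc
    exact h (mem_posInv_iff.2 hc)
  have hcont : Continuous fun t => φ t x := φ.continuous continuous_id continuous_const
  let E : Set ℝ := {t | 0 ≤ t ∧ φ t x ∉ X}
  have hE : E.Nonempty := ⟨r, hr0, hr⟩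
  have hEb : BddBelow E := ⟨0, fun t ht => ht.1⟩
  have h0 : 0 ≤ sInf E := le_csInf hE fun t ht => ht.1
  have hlt : ∀ s, 0 ≤ s → s < sInf E → φ s x ∈ X := fun s hs hs' => by
    by_contra hc
    exact (csInf_le hEb ⟨hs, hc⟩).not_gt hs'
  have hmem : φ (sInf E) x ∈ X := by
    rcases h0.eq_or_lt with h0 | h0
    · rw [← h0]; simpa using hx
    · have hcl : sInf E ∈ closure (Ico 0 (sInf E)) := by
        rw [closure_Ico h0.ne]; exact ⟨h0.le, le_rfl⟩
      exact closure_minimal (fun s hs => hlt s hs.1 hs.2) (hX.preimage hcont) hcl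
  -- The first exit time cannot be an interior hit, since times outside X accumulate at it.
  refine ⟨sInf E, h0, fun s hs => ?_, subset_closure hmem, fun hint => ?_⟩
  · rcases hs.2.eq_or_lt with rfl | hs'
    · exact hmem
    · exact hlt s hs.1 hs'
  · have hcl := csInf_mem_closure hE hEb
    obtain ⟨t, ht, htE⟩ := mem_closure_iff.1 hcl _ (isOpen_interior.preimage hcont) hint
    exact htE.2 (interior_subset ht)

/-- Some `T` forces points whose segment over `[-T, T]` lies in X into the interior. Choosing `W` so
that orbits from it stay in the interior up to time `T` covers early times; at later times the whole
window of radius `T` lies in X. -/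
theorem exists_compact_nhd_maxInv [T2Space M] [LocallyCompactSpace M]
    (hX : IsIsolatingNhd φ X) : ∃ W : Set M, IsCompact W ∧ W ⊆ X ∧ maxInv φ X ⊆ interior W ∧
      ∀ x ∈ W ∩ posInv φ X, ∀ t : ℝ, 0 ≤ t → φ t x ∈ interior X := by
  obtain ⟨T, hT0, hT⟩ := exists_time_of_forall_time φ hX.1 hX.1.isClosed isOpen_interior
    (J := fun T => Icc (-T) T) (U := interior X)
    (fun T T' h => Icc_subset_Icc (neg_le_neg h) h) fun x hx h =>
      hX.2 ⟨hx, fun t => h |t| t ⟨neg_abs_le t, le_abs_self t⟩⟩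
  obtain ⟨W, hWc, hSW, hWU⟩ := exists_compact_between (isCompact_maxInv (φ := φ) hX.1)
    (isOpen_setOf_segment_subset φ continuous_id continuous_const continuous_const
      (fun _ => hT0) (isOpen_interior (s := X)))
    (fun x hx s _ => hX.2 (flow_mem_maxInv hx s))
  refine ⟨W, hWc, fun x hx => interior_subset (mem_of_forall_segment hT0 (hWU hx)), hSW,
    fun x hx t ht => ?_⟩
  rcases le_total t T with htT | htT
  · exact hWU hx.1 t ⟨ht, htT⟩
  · refine hT _ (hx.2.2 t ht) fun s hs => ?_
    rw [← φ.map_add]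
    exact hx.2.2 _ (by linarith [hs.1])

/-- Inside an isolating neighborhood there is an index pair around an admissible pair `(K, K')`
whose exit set contains no point with a forward orbit in `X`. -/
theorem Admissible.exists_indexPair [T2Space M] [LocallyCompactSpace M]
    (hX : IsIsolatingNhd φ X) {K K' : Set M} (hK : Admissible φ X K K') (hKK' : K' ⊆ K) :
    ∃ P : IndexPair φ (maxInv φ X), P.N ⊆ X ∧ K ⊆ P.N ∧ K' ⊆ P.L ∧
      Disjoint P.L (posInv φ X) := by
  obtain ⟨W, hWc, hWX, hSW, hW⟩ := exists_compact_nhd_maxInv hX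
  have hXc := hX.1.isClosed
  have hWK : W ∪ K ⊆ X := union_subset hWX hK.subset_fst
  let N := negInv φ X ∪ forwardSat φ X (W ∪ K)
  have hNX : N ⊆ X := union_subset (fun x hx => hx.1) forwardSat_subset
  have hNc : IsCompact N := hX.1.of_isClosed_subset
    (isClosed_negInv_union_forwardSat hX.1 (hWc.union hK.compact_fst)) hNX
  have hWKN : W ∪ K ⊆ N := (subset_forwardSat hWK).trans subset_union_right
  have hNflow : ∀ x ∈ N, ∀ t : ℝ, 0 ≤ t → (∀ s ∈ Icc 0 t, φ s x ∈ X) → φ t x ∈ N := by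
    rintro x (hx | hx) t ht h
    · exact Or.inl (flow_mem_negInv hx ht h)
    · exact Or.inr (flow_mem_forwardSat hx ht h)
  have hNseg : ∀ x ∈ N, ∀ t : ℝ, (∀ s ∈ Icc 0 t, φ s x ∈ X) → ∀ s ∈ Icc 0 t, φ s x ∈ N :=
    fun x hx t h s hs => hNflow x hx s hs.1 fun r hr => h r ⟨hr.1, hr.2.trans hs.2⟩
  let Z := (N ∩ frontier X) ∪ K'
  have hZc : IsCompact Z := (hNc.inter_right isClosed_frontier).union hK.compact_snd
  have hZN : Z ⊆ N :=
    union_subset inter_subset_left ((hKK'.trans subset_union_right).trans hWKN)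
  -- On the frontier, a point of A⁺(X) with backward orbit in X would lie in Inv X, hence in the
  -- interior; a point reached from `W` or `K` is excluded by the choice of `W` or by
  -- `avoids_frontier`.
  have hZd : Disjoint Z (posInv φ X) := by
    rw [disjoint_left]
    rintro x (⟨hx | ⟨z, hz, t, ht, h, rfl⟩, hf⟩ | hx) hp
    · exact hf.2 (hX.2 (mem_maxInv_of_mem_negInv_of_mem_posInv hx hp))
    · have hzp := mem_posInv_of_flow_mem h hp
      rcases hz with hz | hz
      · exact hf.2 (hW z ⟨hz, hzp⟩ t ht)
      · exact hK.avoids_frontier z ⟨hzp, hz⟩ t ht hf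
    · exact (hK.disjoint_posInv.subset ⟨hx, hp⟩).elim
  let L := forwardSat φ X Z
  have hLc : IsCompact L := isCompact_forwardSat_of_disjoint hXc hZc hZd
  have hLd : Disjoint L (posInv φ X) := disjoint_forwardSat_posInv hZd
  have hLN : L ⊆ N := by
    rintro _ ⟨x, hx, t, ht, h, rfl⟩
    exact hNflow x (hZN hx) t ht h
  have hZL : Z ⊆ L := subset_forwardSat (hZN.trans hNX)
  have hSL : ∀ x ∈ maxInv φ X, x ∉ L := fun x hx hxL =>
    disjoint_left.1 hLd hxL ⟨hx.1, fun t _ => hx.2 t⟩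
  have hnhd : maxInv φ X ⊆ interior (N \ L) := by
    have hsub : maxInv φ X ⊆ interior W \ L := fun x hx => ⟨hSW hx, hSL x hx⟩
    exact hsub.trans (interior_maximal (fun x hx => ⟨hWKN (Or.inl (interior_subset hx.1)), hx.2⟩)
        (isOpen_interior.sdiff hLc.isClosed))
  refine ⟨⟨N, L, hNc, hLc, hLN, hnhd, ?_, ?_, ?_⟩, hNX, subset_union_right.trans hWKN,
    subset_union_right.trans hZL, hLd⟩
  · refine Subset.antisymm (maxInv_mono (closure_minimal (sdiff_subset.trans hNX) hXc)) ?_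
    intro x hx
    have : ∀ t, φ t x ∈ closure (N \ L) := fun t =>
      subset_closure (interior_subset (hnhd (flow_mem_maxInv hx t)))
    exact ⟨by simpa using this 0, this⟩
  · exact fun x hx t _ h s hs =>
      flow_mem_forwardSat hx hs.1 fun r hr => hNX (h r ⟨hr.1, hr.2.trans hs.2⟩)
  · intro x hx hout
    obtain ⟨t, ht, h, hfr⟩ := exists_flow_mem_frontier hXc (hNX hx) fun hp =>
      hout fun t ht => hNseg x hx t (fun s hs => hp.2 s hs.1) t ⟨ht, le_rfl⟩
    have hseg := hNseg x hx t h
    exact ⟨t, ht, hseg, hZL (Or.inl ⟨hseg t ⟨ht, le_rfl⟩, hfr⟩)⟩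

end Existence

/-! ### Flow maps and the connected simple system -/

section FlowMaps

variable {M : Type*} [TopologicalSpace M] {φ : Flow ℝ M} {S : Set M}

namespace IndexPair

/-- An orbit cannot leave `N` without first meeting `L`. This turns staying in `N \ L` into an open
condition. -/
theorem segment_subset_diff_of_avoids (P : IndexPair φ S) {x : M} (hx : x ∈ P.N) {t : ℝ}
    (h : ∀ s ∈ Icc 0 t, φ s x ∉ P.L) : ∀ s ∈ Icc 0 t, φ s x ∈ P.N \ P.L := by
  refine fun s hs => ⟨?_, h s hs⟩
  by_cases hN : ∀ r : ℝ, 0 ≤ r → φ r x ∈ P.N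
  · exact hN s hs.1
  obtain ⟨r, hr, hrN, hrL⟩ := P.exit x hx hN
  refine hrN s ⟨hs.1, hs.2.trans ?_⟩
  by_contra! hlt
  exact h r ⟨hr, hlt.le⟩ hrL

/-- Relative positive invariance: once in `L`, a segment inside `N` would end in `L`. Only the
endpoint needs checking, so this serves for limits of segments. -/
theorem segment_subset_diff_of_end (P : IndexPair φ S) {x : M} {a b : ℝ}
    (h : ∀ s ∈ Icc a b, φ s x ∈ P.N) (hb : φ b x ∉ P.L) :
    ∀ s ∈ Icc a b, φ s x ∈ P.N \ P.L := by
  refine fun s hs => ⟨h s hs, fun hL => hb ?_⟩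
  have := P.posInvariant _ hL (b - s) (sub_nonneg.2 hs.2)
    (fun r hr => by
      rw [← φ.map_add]
      exact h _ ⟨by linarith [hs.1, hr.1], by linarith [hr.2]⟩)
    (b - s) ⟨sub_nonneg.2 hs.2, le_rfl⟩
  rwa [← φ.map_add, sub_add_cancel] at this

theorem closure_diff_subset [T2Space M] (P : IndexPair φ S) : closure (P.N \ P.L) ⊆ P.N :=
  closure_minimal sdiff_subset P.compact_N.isClosed

/-- A map to `N / L` that is given by `[g]` on an open set `D` and is the base point elsewhere is
continuous if `g` takes values in `L` at the boundary of `D`. -/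
theorem continuous_cutoff [T2Space M] (P : IndexPair φ S) {Y : Type*} [TopologicalSpace Y]
    {D : Set Y} {g : Y → M} (hg : Continuous g) (hgN : ∀ y ∈ D, g y ∈ P.N) (hD : IsOpen D)
    (hcl : ∀ y ∈ closure D, g y ∉ P.L → y ∈ D) {F : Y → Collapse P.sub}
    (hF : ∀ y (h : y ∈ D), F y = Collapse.mk P.sub ⟨g y, hgN y h⟩)
    (hF' : ∀ y, y ∉ D → F y = Collapse.pt P.sub) : Continuous F := by
  refine continuous_def.2 fun Z hZ => ?_
  by_cases hpt : Collapse.pt P.sub ∈ Z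
  · obtain ⟨C, hC, hCZ⟩ := isClosed_induced_iff.1
      (hZ.isClosed_compl.preimage (Collapse.continuous_mk P.sub))
    have hCmem : ∀ x : P.N, (x : M) ∈ C ↔ Collapse.mk P.sub x ∉ Z := fun x =>
      Set.ext_iff.1 hCZ x
    -- The points of `closure D` outside `D` drop out: there `g` is in `L`, hence not in `C`.
    have : (F ⁻¹' Z)ᶜ = closure D ∩ g ⁻¹' (C ∩ P.N) := by
      ext y
      constructor
      · intro hy
        by_cases hyD : y ∈ D
        · exact ⟨subset_closure hyD, (hCmem ⟨g y, hgN y hyD⟩).2 (hF y hyD ▸ hy), hgN y hyD⟩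
        · exact (hy (show F y ∈ Z by rwa [hF' y hyD])).elim
      · rintro ⟨hyc, hyC, hyN⟩ hy
        have hnot := (hCmem ⟨g y, hyN⟩).1 hyC
        have hyD := hcl y hyc fun hL => hnot (by
          rwa [Collapse.mk_eq_pt (B := P.sub) (y := ⟨g y, hyN⟩) hL])
        exact hnot (hF y hyD ▸ hy)
    rw [← isClosed_compl_iff, this]
    exact isClosed_closure.inter ((hC.inter P.compact_N.isClosed).preimage hg)
  · obtain ⟨V, hV, hVZ⟩ := isOpen_induced_iff.1 (hZ.preimage (Collapse.continuous_mk P.sub))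
    have hVmem : ∀ x : P.N, (x : M) ∈ V ↔ Collapse.mk P.sub x ∈ Z := fun x =>
      Set.ext_iff.1 hVZ x
    have : F ⁻¹' Z = D ∩ g ⁻¹' V := by
      ext y
      by_cases hyD : y ∈ D
      · simp only [mem_preimage, mem_inter_iff, hyD, true_and, hF y hyD]
        exact (hVmem ⟨g y, hgN y hyD⟩).symm
      · simp [hyD, hF' y hyD, hpt]
    rw [this]
    exact hD.inter (hV.preimage hg)

end IndexPair

theorem LargeTime.mono {P Q : IndexPair φ S} {t t' : ℝ} (h : LargeTime P Q t) (ht : t ≤ t') :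
    LargeTime P Q t' :=
  fun x hx => h x fun s hs => hx s ⟨by linarith [hs.1], hs.2.trans ht⟩

theorem LargeTime.flow_mem {P Q : IndexPair φ S} {t : ℝ} (h : LargeTime P Q t) {x : M} {r : ℝ}
    (hx : ∀ s ∈ Icc (r - t) (r + t), φ s x ∈ closure (P.N \ P.L)) : φ r x ∈ Q.N \ Q.L :=
  h _ fun s hs => by
    rw [← φ.map_add]
    exact hx _ ⟨by linarith [hs.1], by linarith [hs.2]⟩

/-- A full orbit in the closure of `P.N \ P.L` lies in `S`, hence in the interior of `Q.N \ Q.L`;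
compactness replaces the full orbit by a finite segment. -/
theorem exists_largeTime [T2Space M] (P Q : IndexPair φ S) : ∃ t, 0 ≤ t ∧ LargeTime P Q t := by
  have hc : IsCompact (closure (P.N \ P.L)) :=
    P.compact_N.of_isClosed_subset isClosed_closure P.closure_diff_subset
  obtain ⟨T, hT0, hT⟩ := exists_time_of_forall_time φ hc isClosed_closure isOpen_interior
    (J := fun T => Icc (-T) T) (U := interior (Q.N \ Q.L))
    (fun T T' h => Icc_subset_Icc (neg_le_neg h) h) fun x hx h =>
      Q.nhd (P.maxInv_eq ▸ ⟨hx, fun t => h |t| t ⟨neg_abs_le t, le_abs_self t⟩⟩)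
  refine ⟨T, hT0, fun x hx => interior_subset (hT x ?_ hx)⟩
  simpa using hx 0 ⟨by linarith, hT0⟩

/-- A time that is large for `P` and `Q`, in both orders. -/
def BothLarge (P Q : IndexPair φ S) (t : ℝ) : Prop := LargeTime P Q t ∧ LargeTime Q P t

theorem BothLarge.mono {P Q : IndexPair φ S} {t t' : ℝ} (h : BothLarge P Q t) (ht : t ≤ t') :
    BothLarge P Q t' :=
  ⟨h.1.mono ht, h.2.mono ht⟩

theorem exists_bothLarge [T2Space M] (P Q : IndexPair φ S) : ∃ t, 0 ≤ t ∧ BothLarge P Q t := by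
  obtain ⟨t, ht, h⟩ := exists_largeTime P Q
  obtain ⟨t', _, h'⟩ := exists_largeTime Q P
  exact ⟨max t t', ht.trans (le_max_left _ _), h.mono (le_max_left _ _),
    h'.mono (le_max_right _ _)⟩

/-- Gives openness of the flow condition. The first segment puts the time-`t` point in `Q.N`, from
where avoiding `Q.L` suffices. -/
theorem flowCond_iff_avoids {P Q : IndexPair φ S} {t : ℝ} (h : LargeTime P Q t)
    {x : M} (hx : x ∈ P.N) :
    FlowCond P Q t x ↔ (∀ s ∈ Icc 0 (2 * t), φ s x ∈ P.Lᶜ) ∧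
      ∀ s ∈ Icc t (3 * t), φ s x ∈ Q.Lᶜ := by
  refine ⟨fun hc => ⟨fun s hs => (hc.1 s hs).2, fun s hs => (hc.2 s hs).2⟩, fun ⟨hP, hQ⟩ => ?_⟩
  have h1 := P.segment_subset_diff_of_avoids hx hP
  have ht1 : φ t x ∈ Q.N \ Q.L := h.flow_mem fun s hs =>
    subset_closure (h1 s ⟨by linarith [hs.1], by linarith [hs.2]⟩)
  refine ⟨h1, fun s hs => ?_⟩
  have := Q.segment_subset_diff_of_avoids ht1.1 (t := 2 * t) (fun r hr => by
      rw [← φ.map_add]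
      exact hQ _ ⟨by linarith [hr.1], by linarith [hr.2]⟩)
    (s - t) ⟨by linarith [hs.1], by linarith [hs.2]⟩
  rwa [← φ.map_add, sub_add_cancel] at this

/-- Boundary control for the cutoff. The time `2t` is the midpoint of the second segment, so
largeness keeps it off `P.L`, and only the end at `3t` needs a hypothesis. -/
theorem flowCond_of_closure [T2Space M] {P Q : IndexPair φ S} {t : ℝ} (h : LargeTime Q P t)
    {x : M} (hP : ∀ s ∈ Icc 0 (2 * t), φ s x ∈ closure (P.N \ P.L))
    (hQ : ∀ s ∈ Icc t (3 * t), φ s x ∈ closure (Q.N \ Q.L)) (hend : φ (3 * t) x ∉ Q.L) :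
    FlowCond P Q t x := by
  refine ⟨P.segment_subset_diff_of_end (fun s hs => P.closure_diff_subset (hP s hs)) ?_,
    Q.segment_subset_diff_of_end (fun s hs => Q.closure_diff_subset (hQ s hs)) hend⟩
  refine (h.flow_mem fun s hs => hQ s ⟨?_, ?_⟩).2
  · linarith [hs.1]
  · linarith [hs.2]

theorem continuous_flowFun [T2Space M] {P Q : IndexPair φ S} {Y : Type*} [TopologicalSpace Y]
    {u : Y → P.N} {t : Y → ℝ} (hu : Continuous u) (ht : Continuous t) (h0 : ∀ y, 0 ≤ t y)
    (h : ∀ y, BothLarge P Q (t y)) : Continuous fun y => flowFun P Q (t y) (h0 y) (u y) := by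
  have hu' : Continuous fun y => (u y : M) := continuous_subtype_val.comp hu
  refine Q.continuous_cutoff (D := {y | FlowCond P Q (t y) (u y)})
    (g := fun y => φ (3 * t y) (u y)) (φ.continuous (by fun_prop) hu')
    (fun y hy => (hy.2 _ ⟨by linarith [h0 y], le_rfl⟩).1) ?_ (fun y hy hL => ?_)
    (fun y hy => dif_pos hy) (fun y hy => dif_neg hy)
  · have : {y | FlowCond P Q (t y) (u y)} = {y | ∀ s ∈ Icc 0 (2 * t y), φ s (u y) ∈ P.Lᶜ} ∩
        {y | ∀ s ∈ Icc (t y) (3 * t y), φ s (u y) ∈ Q.Lᶜ} :=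
      Set.ext fun y => flowCond_iff_avoids (h y).1 (u y).2
    rw [this]
    exact (isOpen_setOf_segment_subset φ hu' continuous_const (by fun_prop)
      (fun y => by linarith [h0 y]) P.compact_L.isClosed.isOpen_compl).inter
      (isOpen_setOf_segment_subset φ hu' ht (by fun_prop)
      (fun y => by linarith [h0 y]) Q.compact_L.isClosed.isOpen_compl)
  · refine flowCond_of_closure (h y).2 ?_ ?_ hL
    · exact closure_minimal (fun z (hz : FlowCond P Q (t z) (u z)) s hs =>
          subset_closure (hz.1 s hs))
        (isClosed_setOf_segment_subset φ hu' continuous_const (by fun_prop)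
          (fun y => by linarith [h0 y]) isClosed_closure) hy
    · exact closure_minimal (fun z (hz : FlowCond P Q (t z) (u z)) s hs =>
          subset_closure (hz.2 s hs))
        (isClosed_setOf_segment_subset φ hu' ht (by fun_prop)
          (fun y => by linarith [h0 y]) isClosed_closure) hy

theorem flowFun_eq_pt {P Q : IndexPair φ S} {t : ℝ} (ht : 0 ≤ t) {x : P.N} (hx : x ∈ P.sub) :
    flowFun P Q t ht x = Collapse.pt Q.sub :=
  dif_neg fun h => (h.1 0 ⟨le_rfl, by linarith⟩).2 (by
    rw [φ.map_zero_apply]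
    exact hx)

/-- The flow map at a large time. -/
noncomputable def flowMap [T2Space M] (P Q : IndexPair φ S) (t : ℝ) (ht : 0 ≤ t) (h : BothLarge P Q t) :
    BasedMap P.sub Q.sub :=
  ⟨Collapse.lift P.sub
    ⟨flowFun P Q t ht, continuous_flowFun continuous_id continuous_const (fun _ => ht)
      fun _ => h⟩ (Collapse.pt Q.sub) (fun _ hx => flowFun_eq_pt ht hx), rfl⟩

theorem flowMap_mk [T2Space M] {P Q : IndexPair φ S} {t : ℝ} (ht : 0 ≤ t) (h : BothLarge P Q t) (x : P.N) :
    (flowMap P Q t ht h).1 (Collapse.mk P.sub x) = flowFun P Q t ht x := rfl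

theorem isFlowMap_flowMap [T2Space M] {P Q : IndexPair φ S} {t : ℝ} (ht : 0 ≤ t) (h : BothLarge P Q t) :
    IsFlowMap P Q (flowMap P Q t ht h) :=
  ⟨t, ht, h.1, h.2, fun _ => rfl⟩

theorem IsFlowMap.eq_flowMap [T2Space M] {P Q : IndexPair φ S} {F : BasedMap P.sub Q.sub}
    (hF : IsFlowMap P Q F) : ∃ (t : ℝ) (ht : 0 ≤ t) (h : BothLarge P Q t),
      F = flowMap P Q t ht h := by
  obtain ⟨t, ht, h, h', hF⟩ := hF
  exact ⟨t, ht, ⟨h, h'⟩, BasedMap.ext hF⟩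

theorem exists_isFlowMap [T2Space M] (P Q : IndexPair φ S) : ∃ F, IsFlowMap P Q F := by
  obtain ⟨t, ht, h⟩ := exists_bothLarge P Q
  exact ⟨_, isFlowMap_flowMap ht h⟩

theorem flowMap_homotopic_of_le [T2Space M] {P Q : IndexPair φ S} {t t' : ℝ} (ht : 0 ≤ t)
    (h : BothLarge P Q t) (htt' : t ≤ t') :
    (flowMap P Q t ht h).Homotopic (flowMap P Q t' (ht.trans htt') (h.mono htt')) := by
  have hle : ∀ p : P.N × unitInterval, t ≤ t + p.2 * (t' - t) := fun p =>
    le_add_of_nonneg_right (mul_nonneg p.2.2.1 (sub_nonneg.2 htt'))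
  refine BasedMap.homotopic_of_family
    ⟨fun p => flowFun P Q (t + p.2 * (t' - t)) (ht.trans (hle p)) p.1,
      continuous_flowFun continuous_fst (by fun_prop) _ fun p => h.mono (hle p)⟩
    (fun x hx s => flowFun_eq_pt (ht.trans (hle (x, s))) hx) (fun x => ?_) fun x => ?_
  · simp [flowMap_mk]
  · simp [flowMap_mk]

theorem flowMap_homotopic [T2Space M] {P Q : IndexPair φ S} {t t' : ℝ} (ht : 0 ≤ t) (ht' : 0 ≤ t')
    (h : BothLarge P Q t) (h' : BothLarge P Q t') :
    (flowMap P Q t ht h).Homotopic (flowMap P Q t' ht' h') :=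
  (le_total t t').elim (flowMap_homotopic_of_le ht h)
    fun hle => (flowMap_homotopic_of_le ht' h' hle).symm

/-- The left side is `P` on `[0,2t]`, `Q` on `[t,5t]`, `R` on `[4t,6t]`; the right side is `P` on
`[0,4t]`, `R` on `[2t,6t]`. Largeness shortens a segment by `t` at each end when passing between
pairs, which fills exactly the missing parts. -/
theorem flowCond_comp_iff {P Q R : IndexPair φ S} {t : ℝ} (ht : 0 ≤ t) (hPQ : BothLarge P Q t)
    (hQR : BothLarge Q R t) (x : M) :
    FlowCond P Q t x ∧ FlowCond Q R t (φ (3 * t) x) ↔ FlowCond P R (2 * t) x := by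
  constructor
  · rintro ⟨⟨hP, hQ⟩, hQ', hR⟩
    have hQ5 : ∀ s ∈ Icc t (5 * t), φ s x ∈ closure (Q.N \ Q.L) := fun s hs => by
      rcases le_total s (3 * t) with hst | hst
      · exact subset_closure (hQ s ⟨hs.1, hst⟩)
      · have := hQ' (s - 3 * t) ⟨by linarith, by linarith [hs.2]⟩
        rw [← φ.map_add, sub_add_cancel] at this
        exact subset_closure this
    refine ⟨fun s hs => ?_, fun s hs => ?_⟩
    · rcases le_total s (2 * t) with hst | hst
      · exact hP s ⟨hs.1, hst⟩
      · exact hPQ.2.flow_mem fun r hr => hQ5 r ⟨by linarith [hr.1], by linarith [hr.2, hs.2]⟩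
    · rcases le_total s (4 * t) with hst | hst
      · exact hQR.1.flow_mem fun r hr => hQ5 r ⟨by linarith [hr.1, hs.1], by linarith [hr.2]⟩
      · have := hR (s - 3 * t) ⟨by linarith, by linarith [hs.2]⟩
        rwa [← φ.map_add, sub_add_cancel] at this
  · rintro ⟨hP, hR⟩
    have hQ : ∀ s ∈ Icc t (5 * t), φ s x ∈ Q.N \ Q.L := fun s hs => by
      rcases le_total s (3 * t) with hst | hst
      · exact hPQ.1.flow_mem fun r hr =>
          subset_closure (hP r ⟨by linarith [hr.1, hs.1], by linarith [hr.2]⟩)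
      · exact hQR.2.flow_mem fun r hr =>
          subset_closure (hR r ⟨by linarith [hr.1], by linarith [hr.2, hs.2]⟩)
    refine ⟨⟨fun s hs => hP s ⟨hs.1, by linarith [hs.2]⟩,
      fun s hs => hQ s ⟨hs.1, by linarith [hs.2]⟩⟩, fun s hs => ?_, fun s hs => ?_⟩
    · rw [← φ.map_add]
      exact hQ _ ⟨by linarith [hs.1], by linarith [hs.2]⟩
    · rw [← φ.map_add]
      exact hR _ ⟨by linarith [hs.1], by linarith [hs.2]⟩

theorem flowMap_comp_flowMap [T2Space M] {P Q R : IndexPair φ S} {t : ℝ} (ht : 0 ≤ t)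
    (hPQ : BothLarge P Q t) (hQR : BothLarge Q R t) (ht2 : 0 ≤ 2 * t)
    (hPR : BothLarge P R (2 * t)) :
    (flowMap Q R t ht hQR).comp (flowMap P Q t ht hPQ) = flowMap P R (2 * t) ht2 hPR := by
  refine BasedMap.ext fun x => ?_
  have hcomp : ((flowMap Q R t ht hQR).comp (flowMap P Q t ht hPQ)).1 (Collapse.mk P.sub x) =
      (flowMap Q R t ht hQR).1 (flowFun P Q t ht x) := rfl
  have hiff := flowCond_comp_iff ht hPQ hQR (x : M)
  rw [hcomp, flowMap_mk]
  by_cases h1 : FlowCond P Q t x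
  · rw [flowFun, dif_pos h1, flowMap_mk]
    by_cases h2 : FlowCond Q R t (φ (3 * t) x)
    · rw [flowFun, flowFun, dif_pos h2, dif_pos (hiff.1 ⟨h1, h2⟩)]
      congr 2
      simp only
      rw [← φ.map_add]
      ring_nf
    · rw [flowFun, flowFun, dif_neg h2, dif_neg fun h => h2 (hiff.2 h).2]
  · rw [flowFun, flowFun, dif_neg h1, dif_neg fun h => h1 (hiff.2 h).1]
    exact (flowMap Q R t ht hQR).2

/-- Flow maps compose to flow maps, up to homotopy. -/
theorem IsFlowMap.comp_homotopic [T2Space M] {P Q R : IndexPair φ S} {F : BasedMap P.sub Q.sub}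
    {G : BasedMap Q.sub R.sub} {H : BasedMap P.sub R.sub} (hF : IsFlowMap P Q F)
    (hG : IsFlowMap Q R G) (hH : IsFlowMap P R H) : (G.comp F).Homotopic H := by
  obtain ⟨t₁, h₁, hPQ, rfl⟩ := hF.eq_flowMap
  obtain ⟨t₂, h₂, hQR, rfl⟩ := hG.eq_flowMap
  obtain ⟨t₃, h₃, hPR, rfl⟩ := hH.eq_flowMap
  -- A common time above all three, so that the two factors can run at `t` and the composite at
  -- `2t`.
  let t := t₁ + t₂ + t₃
  have ht : 0 ≤ t := by positivity
  have hPQ' : BothLarge P Q t := hPQ.mono (by linarith [show t = t₁ + t₂ + t₃ from rfl])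
  have hQR' : BothLarge Q R t := hQR.mono (by linarith [show t = t₁ + t₂ + t₃ from rfl])
  have hPR' : BothLarge P R (2 * t) := hPR.mono (by linarith [show t = t₁ + t₂ + t₃ from rfl])
  refine ((BasedMap.Homotopic.postcomp _ (flowMap_homotopic h₁ ht hPQ hPQ')).trans
    ((flowMap_homotopic h₂ ht hQR hQR').precomp _)).trans ?_
  rw [flowMap_comp_flowMap ht hPQ' hQR' (by linarith) hPR']
  exact flowMap_homotopic _ h₃ hPR' hPR

end FlowMaps

/-! ### Compatibility of the induced maps with flow maps -/

section InducedMaps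

variable {M : Type*} [TopologicalSpace M] {φ : Flow ℝ M} {X : Set M}
  {A : Type*} [TopologicalSpace A] {B : Set A} {f : C(A, M)}
  {P Q : IndexPair φ (maxInv φ X)}

theorem inducedMap_mk (hQ : Surrounds Q f B) (a : A) :
    (inducedMap hQ).1 (Collapse.mk B a) = Collapse.mk Q.sub ⟨f a, hQ.mapsTo_N a⟩ := rfl

open Classical in
/-- Pushing `f` along the flow inside `N \ L`, and into the base point once `L` is reached, does
not change the based homotopy class of the map `[a] ↦ [f(a)]`. -/
theorem inducedMap_homotopic_of_forward [T2Space M] (hQ : Surrounds Q f B) {T : ℝ} (hT : 0 ≤ T)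
    {G : BasedMap B Q.sub}
    (hG : ∀ a, G.1 (Collapse.mk B a) = if h : ∀ s ∈ Icc 0 T, φ s (f a) ∈ Q.N \ Q.L then
      Collapse.mk Q.sub ⟨φ T (f a), (h T ⟨hT, le_rfl⟩).1⟩ else Collapse.pt Q.sub) :
    (inducedMap hQ).Homotopic G := by
  have h0 : ∀ p : A × unitInterval, 0 ≤ p.2 * T := fun p => mul_nonneg p.2.2.1 hT
  let D : Set (A × unitInterval) := {p | ∀ s ∈ Icc 0 (p.2 * T), φ s (f p.1) ∈ Q.N \ Q.L}
  have hDN : ∀ p ∈ D, φ (p.2 * T) (f p.1) ∈ Q.N := fun p hp => (hp _ ⟨h0 p, le_rfl⟩).1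
  let F : A × unitInterval → Collapse Q.sub := fun p =>
    if h : p ∈ D then Collapse.mk Q.sub ⟨φ (p.2 * T) (f p.1), hDN p h⟩ else Collapse.pt Q.sub
  have hcont : Continuous F := by
    refine Q.continuous_cutoff (D := D) (g := fun p => φ (p.2 * T) (f p.1))
      (φ.continuous (by fun_prop) (by fun_prop)) hDN ?_ (fun p hp hL => ?_)
      (fun p hp => dif_pos hp) (fun p hp => dif_neg hp)
    · have : D = {p : A × unitInterval | ∀ s ∈ Icc 0 (p.2 * T), φ s (f p.1) ∈ Q.Lᶜ} :=
        Set.ext fun p => ⟨fun hp s hs => (hp s hs).2,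
          fun hp => Q.segment_subset_diff_of_avoids (hQ.mapsTo_N _) hp⟩
      rw [this]
      exact isOpen_setOf_segment_subset φ (by fun_prop) continuous_const (by fun_prop) h0
        Q.compact_L.isClosed.isOpen_compl
    · refine Q.segment_subset_diff_of_end ?_ hL
      exact closure_minimal (fun z (hz : z ∈ D) s hs => (hz s hs).1)
        (isClosed_setOf_segment_subset φ (g := fun p : A × unitInterval => f p.1)
          (b := fun p => p.2 * T) (by fun_prop) continuous_const (by fun_prop) h0
          Q.compact_N.isClosed) hp
  refine BasedMap.homotopic_of_family ⟨F, hcont⟩ (fun b hb s => ?_) (fun a => ?_) fun a => ?_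
  · refine dif_neg fun h => (h 0 ⟨le_rfl, h0 (b, s)⟩).2 ?_
    rw [φ.map_zero_apply]
    exact hQ.mapsTo_L b hb
  · rw [inducedMap_mk]
    by_cases ha : f a ∈ Q.L
    · have hmk : Collapse.mk Q.sub ⟨f a, hQ.mapsTo_N a⟩ = Collapse.pt Q.sub :=
        Collapse.mk_eq_pt ha
      rw [hmk]
      exact dif_neg fun h => (h 0 ⟨le_rfl, h0 (a, 0)⟩).2 (by rwa [φ.map_zero_apply])
    · have hD : (a, (0 : unitInterval)) ∈ D := fun s hs => by
        obtain rfl : s = 0 := le_antisymm (by simpa using hs.2) hs.1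
        rw [φ.map_zero_apply]
        exact ⟨hQ.mapsTo_N a, ha⟩
      refine (dif_pos hD).trans ?_
      simp
  · rw [hG]
    change F (a, 1) = _
    simp only [F, D, mem_ofPred_eq, Set.Icc.coe_one, one_mul]

/-- Largeness transfers membership between the pairs except within `t₁` of the start. There
compactness of `f(A)` helps: `avoids_L` holds for orbits staying in X forever, so staying in X up to
some `T` already keeps `[0, t₁]` off both exit sets. -/
theorem exists_time_flowCond_iff [T2Space M] [CompactSpace A] (hX : IsCompact X)
    (hP : Surrounds P f B) (hQ : Surrounds Q f B) : ∃ T, 0 ≤ T ∧ ∀ t, T ≤ t → ∀ a,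
      (FlowCond P Q t (f a) ↔ ∀ s ∈ Icc 0 (3 * t), φ s (f a) ∈ Q.N \ Q.L) := by
  obtain ⟨t₁, ht₁, hPQ⟩ := exists_bothLarge P Q
  obtain ⟨T, hT0, hT⟩ := exists_time_of_forall_time φ (isCompact_range f.continuous) hX.isClosed
    (isOpen_setOf_segment_subset φ continuous_id continuous_const continuous_const
      (fun _ => ht₁) (P.compact_L.union Q.compact_L).isClosed.isOpen_compl)
    (J := fun T => Icc 0 T) (fun T T' h => Icc_subset_Icc_right h) fun x hx h s hs => by
      have hxX : x ∈ posInv φ X ∩ range f :=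
        ⟨mem_posInv_iff.2 fun t ht => h t t ⟨ht, le_rfl⟩, hx⟩
      exact fun hL => hL.elim (hP.avoids_L x hxX s hs.1) (hQ.avoids_L x hxX s hs.1)
  refine ⟨t₁ + T, add_nonneg ht₁ hT0, fun t ht a => ⟨fun h s hs => ?_, fun h => ⟨fun s hs => ?_,
    fun s hs => h s ⟨by linarith [hs.1], hs.2⟩⟩⟩⟩
  · have hav := hT (f a) ⟨a, rfl⟩ fun s hs =>
      hP.N_subset (h.1 s ⟨hs.1, by linarith [hs.2]⟩).1
    rcases le_total s t₁ with h1 | h1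
    · exact Q.segment_subset_diff_of_avoids (hQ.mapsTo_N a)
        (fun r hr hL => hav r hr (Or.inr hL)) s ⟨hs.1, h1⟩
    rcases le_total s t with h2 | h2
    · exact hPQ.1.flow_mem fun r hr =>
        subset_closure (h.1 r ⟨by linarith [hr.1], by linarith [hr.2]⟩)
    · exact h.2 s ⟨h2, hs.2⟩
  · have hav := hT (f a) ⟨a, rfl⟩ fun s hs =>
      hQ.N_subset (h s ⟨hs.1, by linarith [hs.2]⟩).1
    rcases le_total s t₁ with h1 | h1
    · exact P.segment_subset_diff_of_avoids (hP.mapsTo_N a)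
        (fun r hr hL => hav r hr (Or.inl hL)) s ⟨hs.1, h1⟩
    · exact hPQ.2.flow_mem fun r hr =>
        subset_closure (h r ⟨by linarith [hr.1], by linarith [hr.2, hs.2]⟩)

/-- Flow maps take the map induced by `f` to the map induced by `f`, up to homotopy. -/
theorem IsFlowMap.comp_inducedMap_homotopic [T2Space M] [CompactSpace A] (hX : IsCompact X)
    (hP : Surrounds P f B) (hQ : Surrounds Q f B) {F : BasedMap P.sub Q.sub}
    (hF : IsFlowMap P Q F) : (F.comp (inducedMap hP)).Homotopic (inducedMap hQ) := by
  obtain ⟨t, ht, hPQ, rfl⟩ := hF.eq_flowMap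
  obtain ⟨T, hT0, hT⟩ := exists_time_flowCond_iff hX hP hQ
  have ht' : 0 ≤ t + T := add_nonneg ht hT0
  have hPQ' : BothLarge P Q (t + T) := hPQ.mono (by linarith)
  refine ((flowMap_homotopic ht ht' hPQ hPQ').precomp _).trans ?_
  refine (inducedMap_homotopic_of_forward hQ (T := 3 * (t + T)) (by linarith) fun a => ?_).symm
  have hcomp : ((flowMap P Q (t + T) ht' hPQ').comp (inducedMap hP)).1 (Collapse.mk B a) =
      flowFun P Q (t + T) ht' ⟨f a, hP.mapsTo_N a⟩ := rfl
  rw [hcomp, flowFun]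
  have hiff := hT (t + T) (by linarith) a
  by_cases h : FlowCond P Q (t + T) (f a)
  · rw [dif_pos h, dif_pos (hiff.1 h)]
  · rw [dif_neg h, dif_neg fun h' => h (hiff.2 h')]

end InducedMaps

/-! ### Maps to the index from a single component -/

section MapToIndex

variable {M : Type*} [TopologicalSpace M] [T2Space M] {φ : Flow ℝ M} {S : Set M}
  {A : Type*} [TopologicalSpace A] {B : Set A}

/-- The map to the Conley index that is determined by its component at one index pair. -/
noncomputable def MapToConleyIndex.ofComponent (P : IndexPair φ S) (g : BasedMap B P.sub) :
    MapToConleyIndex B φ S where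
  app Q := ((exists_isFlowMap P Q).choose.comp g).toClass
  naturality _ R _ hF :=
    Quotient.sound (((exists_isFlowMap P _).choose_spec.comp_homotopic hF
      (exists_isFlowMap P R).choose_spec).precomp g)

theorem MapToConleyIndex.ext_of_component {G H : MapToConleyIndex B φ S} (P : IndexPair φ S)
    (h : G.app P = H.app P) : G = H := by
  refine MapToConleyIndex.ext (funext fun Q => ?_)
  obtain ⟨F, hF⟩ := exists_isFlowMap P Q
  rw [← G.naturality P Q F hF, ← H.naturality P Q F hF, h]

end MapToIndex

end ConleyMap

theorem propositionA4 {M : Type*} [TopologicalSpace M] [T2Space M] [LocallyCompactSpace M]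
    (φ : Flow ℝ M) (X : Set M) (hX : ConleyMap.IsIsolatingNhd φ X)
    {A : Type*} [TopologicalSpace A] [CompactSpace A] (B : Set A) (hB : IsCompact B)
    (f : C(A, M)) (hfX : ∀ a, f a ∈ X)
    (hf : ConleyMap.Admissible φ X (Set.range f) (f '' B)) :
    (∃ P : ConleyMap.IndexPair φ (ConleyMap.maxInv φ X), ConleyMap.Surrounds P f B) ∧
    (∀ (P Q : ConleyMap.IndexPair φ (ConleyMap.maxInv φ X))
        (hP : ConleyMap.Surrounds P f B) (hQ : ConleyMap.Surrounds Q f B),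
      (∃ F : ConleyMap.BasedMap P.sub Q.sub, ConleyMap.IsFlowMap P Q F) ∧
      ∀ F : ConleyMap.BasedMap P.sub Q.sub, ConleyMap.IsFlowMap P Q F →
        (F.comp (ConleyMap.inducedMap hP)).Homotopic (ConleyMap.inducedMap hQ)) ∧
    ∃! G : ConleyMap.MapToConleyIndex B φ (ConleyMap.maxInv φ X),
      ∀ (P : ConleyMap.IndexPair φ (ConleyMap.maxInv φ X)) (hP : ConleyMap.Surrounds P f B),
        G.app P = (ConleyMap.inducedMap hP).toClass := by
  obtain ⟨P, hPX, hPN, hPL, hPd⟩ := hf.exists_indexPair hX (Set.image_subset_range f B)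
  have hP : ConleyMap.Surrounds P f B := ⟨hPX, fun a => hPN ⟨a, rfl⟩, fun b hb => hPL ⟨b, hb, rfl⟩,
    fun x hx t ht hL => Set.disjoint_left.1 hPd hL (ConleyMap.flow_mem_posInv hx.1 ht)⟩
  refine ⟨⟨P, hP⟩, fun Q R hQ hR => ⟨ConleyMap.exists_isFlowMap Q R,
    fun F hF => hF.comp_inducedMap_homotopic hX.1 hQ hR⟩, ?_⟩
  have hG : ∀ (Q : ConleyMap.IndexPair φ (ConleyMap.maxInv φ X)) (hQ : ConleyMap.Surrounds Q f B),
      (ConleyMap.MapToConleyIndex.ofComponent P (ConleyMap.inducedMap hP)).app Q =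
        (ConleyMap.inducedMap hQ).toClass := fun Q hQ =>
    Quotient.sound ((ConleyMap.exists_isFlowMap P Q).choose_spec.comp_inducedMap_homotopic
      hX.1 hP hQ)
  exact ⟨_, hG, fun G hG' =>
    ConleyMap.MapToConleyIndex.ext_of_component P ((hG' P hP).trans (hG P hP).symm)⟩
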